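/- Let $\mathbb D$ be the open unit disc, $\mathcal H(\mathbb D)$ the space of analytic functions on $\mathbb D$, and $H^\infty$ the space of bounded functions in $\mathcal H(\mathbb D)$. For $1\le p,q<\infty$ let $RM(p,q)$ be the space of all $f\in\mathcal H(\mathbb D)$ with $$\|f\|_{RM(p,q)}=\left(\frac1{2\pi}\int_0^{2\pi}\left(\int_0^1|f(re^{i\theta})|^p\,dr\right)^{q/p}d\theta\right)^{1/q}<\infty .$$ For $f,g\in\mathcal H(\mathbb D)$ put $S_g f(z)=\int_0^z f'(\zeta)\,g(\zeta)\,d\zeta$, $z\in\mathbb D$. Let $1\le p,q<\infty$ and $g\in\mathcal H(\mathbb D)$. Then $S_g$ is bounded on $RM(p,q)$, that is, $S_g$ maps $RM(p,q)$ into itself and there is a constant $C$ such that $\|S_g f\|_{RM(p,q)}\le C\,\|f\|_{RM(p,q)}$ for all $f\in RM(p,q)$, if and only if $g\in H^\infty$. -/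

import Mathlib

open scoped ENNReal NNReal

noncomputable section

/-- The open unit disc of the complex plane. -/
def unitDisc : Set ℂ := Metric.ball (0 : ℂ) 1

/-- `f` is analytic in the open unit disc. Values of `f` off the disc are irrelevant to this and to
all definitions below. -/
def IsAnalyticOnDisc (f : ℂ → ℂ) : Prop := DifferentiableOn ℂ f unitDisc

/-- The norm of average radial integrability
`((1 / 2π) ∫_0^{2π} (∫_0^1 |f (r e^{iθ})|^p dr)^{q/p} dθ)^{1/q}`, with values in `[0, ∞]`
(for finite positive exponents). -/
def rhoRM (p q : ℝ) (f : ℂ → ℂ) : ℝ≥0∞ :=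
  (ENNReal.ofReal (1 / (2 * Real.pi)) *
    ∫⁻ θ in Set.Ioo (0 : ℝ) (2 * Real.pi),
      (∫⁻ r in Set.Ioo (0 : ℝ) 1,
        ‖f ((r : ℂ) * Complex.exp ((θ : ℂ) * Complex.I))‖ₑ ^ p) ^ (q / p)) ^ (1 / q)

/-- Membership in the space `RM(p, q)` of average radial integrability. -/
def MemRM (p q : ℝ) (f : ℂ → ℂ) : Prop :=
  IsAnalyticOnDisc f ∧ rhoRM p q f < ∞

/-- Membership in `H^∞`, the bounded analytic functions in the unit disc. -/
def MemHInfty (g : ℂ → ℂ) : Prop :=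
  IsAnalyticOnDisc g ∧ ∃ M : ℝ, ∀ z ∈ unitDisc, ‖g z‖ ≤ M

/-- The integral operator `S_g f (z) = ∫_0^z f'(ζ) g(ζ) dζ`, the path of integration being the
segment `ζ = t z`, `0 ≤ t ≤ 1`. -/
def opS (g f : ℂ → ℂ) (z : ℂ) : ℂ :=
  ∫ t in (0 : ℝ)..1, deriv f ((t : ℂ) * z) * g ((t : ℂ) * z) * z

/-- The operator `S_g` is bounded on `RM(p, q)`: it maps `RM(p, q)` into itself, with
`‖S_g f‖ ≤ C ‖f‖` for a constant `C` independent of `f`. -/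
def IsBoundedOpS (p q : ℝ) (g : ℂ → ℂ) : Prop :=
  ∃ C : ℝ≥0, ∀ f : ℂ → ℂ, MemRM p q f →
    MemRM p q (opS g f) ∧ rhoRM p q (opS g f) ≤ (C : ℝ≥0∞) * rhoRM p q f

end

open MeasureTheory Set

/-! If `g` is bounded by `M`, integration by parts (`opS_add_opS`) gives S_g f = f g - f(0) g(0) - ∫
g' f. Cauchy's estimate |g'(z)| ≤ 2M/(1-|z|) dominates the last term on each ray by a constant times
∫_0^r |f|/(1-s) ds, which Hardy's inequality (`lintegral_rpow_hardy_le`) bounds in L^p(dr). The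
constant does not depend on the ray, so integration in θ is harmless; f(0) is controlled by
`exists_enorm_le_mul_rhoRM`.

Conversely, S_g multiplies derivatives by `g`, so S_g^n applied to the identity has derivative g^n.
Since F ↦ F'(a) is bounded on RM(p, q), |g(a)|^n ≤ K C^n ‖id‖ for all n, where K depends on a but
not on n. Hence |g(a)| ≤ C. -/

/-! ### Jensen's and Hardy's inequalities. -/

/-- Jensen's inequality for powers, without any measurability assumption. -/
theorem rpow_lintegral_le_mul_lintegral_rpow {α : Type*} [MeasurableSpace α] (ν : Measure α)
    {p : ℝ} (hp : 1 ≤ p) (ψ : α → ℝ≥0∞) :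
    (∫⁻ x, ψ x ∂ν) ^ p ≤ ν univ ^ (p - 1) * ∫⁻ x, ψ x ^ p ∂ν := by
  rcases hp.eq_or_lt with rfl | hp
  · simp
  -- Hölder needs measurability; a measurable minorant of `ψ` has the same lower integral.
  obtain ⟨φ, hφ, hle, heq⟩ := exists_measurable_le_lintegral_eq ν ψ
  have hpq : p.HolderConjugate (p / (p - 1)) := Real.HolderConjugate.conjExponent hp
  have h := ENNReal.lintegral_mul_le_Lp_mul_Lq ν hpq hφ.aemeasurable
    (aemeasurable_const (b := (1 : ℝ≥0∞)))
  simp only [Pi.mul_apply, mul_one, ENNReal.one_rpow, lintegral_const, one_mul] at h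
  have hp0 : 0 < p := by linarith
  rw [heq]
  calc (∫⁻ x, φ x ∂ν) ^ p
      ≤ ((∫⁻ x, φ x ^ p ∂ν) ^ (1 / p) * ν univ ^ (1 / (p / (p - 1)))) ^ p := by gcongr
    _ = ν univ ^ (p - 1) * ∫⁻ x, φ x ^ p ∂ν := by
        rw [ENNReal.mul_rpow_of_nonneg _ _ hp0.le, ← ENNReal.rpow_mul, ← ENNReal.rpow_mul,
          one_div_mul_cancel hp0.ne', ENNReal.rpow_one, mul_comm]
        congr 2
        field_simp
    _ ≤ _ := by
        gcongr with x
        exact hle x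

theorem setLIntegral_one_sub_rpow_le {c r : ℝ} (hc : 0 < c) (h0 : 0 < r) (hr : r < 1) :
    ∫⁻ s in Ioo 0 r, ENNReal.ofReal (1 - s) ^ (-c - 1) ≤
      ENNReal.ofReal c⁻¹ * ENNReal.ofReal (1 - r) ^ (-c) := by
  have hpos : ∀ s ∈ Ioo 0 r, 0 < 1 - s := fun s hs => by linarith [hs.2]
  have hzero : (0 : ℝ) ∉ uIcc (1 - r) 1 := by
    rw [uIcc_of_le (by linarith)]
    exact fun h => by linarith [h.1]
  have hint : IntervalIntegrable (fun s : ℝ => (1 - s) ^ (-c - 1)) volume 0 r := by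
    have := (intervalIntegral.intervalIntegrable_rpow (μ := volume) (r := -c - 1)
      (a := 1 - r) (b := 1) (Or.inr hzero)).comp_sub_left 1
    simpa using this.symm
  rw [setLIntegral_congr_fun (g := fun s => ENNReal.ofReal ((1 - s) ^ (-c - 1))) measurableSet_Ioo
    (fun s hs => ENNReal.ofReal_rpow_of_pos (hpos s hs)),
    ENNReal.ofReal_rpow_of_pos (by linarith), ← ENNReal.ofReal_mul (by positivity),
    ← ofReal_integral_eq_lintegral_ofReal, ← integral_Ioc_eq_integral_Ioo,
    ← intervalIntegral.integral_of_le h0.le,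
    intervalIntegral.integral_comp_sub_left (fun x : ℝ => x ^ (-c - 1)) 1, sub_zero,
    integral_rpow (Or.inr ⟨by linarith, hzero⟩)]
  · apply ENNReal.ofReal_le_ofReal
    simp only [sub_add_cancel, Real.one_rpow]
    rw [div_neg, ← neg_div, neg_sub, div_eq_inv_mul]
    gcongr
    linarith
  · rwa [intervalIntegrable_iff_integrableOn_Ioo_of_le h0.le] at hint
  · filter_upwards [ae_restrict_mem measurableSet_Ioo] with s hs
    have := hpos s hs
    positivity

theorem setLIntegral_one_sub_rpow {c s : ℝ} (hc : 0 < c) (hs : s < 1) :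
    ∫⁻ r in Ioo s 1, ENNReal.ofReal (1 - r) ^ (c - 1) =
      ENNReal.ofReal c⁻¹ * ENNReal.ofReal (1 - s) ^ c := by
  have hpos : ∀ r ∈ Ioo s 1, 0 < 1 - r := fun r hr => by linarith [hr.2]
  have hint : IntervalIntegrable (fun r : ℝ => (1 - r) ^ (c - 1)) volume s 1 := by
    have := (intervalIntegral.intervalIntegrable_rpow' (r := c - 1)
      (a := 0) (b := 1 - s) (by linarith)).comp_sub_left 1
    simpa using this.symm
  rw [setLIntegral_congr_fun (g := fun r => ENNReal.ofReal ((1 - r) ^ (c - 1))) measurableSet_Ioo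
    (fun s hs => ENNReal.ofReal_rpow_of_pos (hpos s hs)),
    ENNReal.ofReal_rpow_of_pos (by linarith), ← ENNReal.ofReal_mul (by positivity),
    ← ofReal_integral_eq_lintegral_ofReal, ← integral_Ioc_eq_integral_Ioo,
    ← intervalIntegral.integral_of_le hs.le,
    intervalIntegral.integral_comp_sub_left (fun x : ℝ => x ^ (c - 1)) 1, sub_self,
    integral_rpow (Or.inl (by linarith))]
  · rw [sub_add_cancel, Real.zero_rpow hc.ne', sub_zero, div_eq_inv_mul]
  · rwa [intervalIntegrable_iff_integrableOn_Ioo_of_le hs.le] at hint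
  · filter_upwards [ae_restrict_mem measurableSet_Ioo] with s hs
    have := hpos s hs
    positivity

/-- Hardy's inequality on the unit interval, with the weight at the right end point. -/
theorem lintegral_rpow_hardy_le {p : ℝ} (hp : 1 ≤ p) {φ : ℝ → ℝ≥0∞} (hφ : Measurable φ) :
    ∫⁻ r in Ioo (0 : ℝ) 1, (∫⁻ s in Ioo 0 r, φ s / ENNReal.ofReal (1 - s)) ^ p ≤
      ENNReal.ofReal p ^ p * ∫⁻ s in Ioo (0 : ℝ) 1, φ s ^ p := by
  have hp0 : 0 < p := by linarith
  set w : ℝ → ℝ≥0∞ := fun s => ENNReal.ofReal (1 - s) with hw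
  have hwm : Measurable w := by fun_prop
  have hw0 : ∀ s < 1, w s ≠ 0 := fun s hs => by simpa [hw] using hs
  have hwt : ∀ s, w s ≠ ∞ := fun s => ENNReal.ofReal_ne_top
  set G : ℝ → ℝ≥0∞ := fun s => φ s ^ p * w s ^ (-p⁻¹) with hG
  have hGm : Measurable G := by fun_prop
  have hpt : ∀ r ∈ Ioo (0 : ℝ) 1, (∫⁻ s in Ioo 0 r, φ s / w s) ^ p ≤
      ENNReal.ofReal p ^ (p - 1) * (w r ^ (p⁻¹ - 1) * ∫⁻ s in Ioo 0 r, G s) := by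
    intro r hr
    -- Schur-test weight: φ/w ds = φ w^(1/p) dν, where ν has mass at most p (1-r)^(-1/p). After
    -- Jensen and Tonelli, ∫_s^1 (1-r)^(1/p-1) dr = p (1-s)^(1/p) cancels the weight in `G`.
    set ν := (volume.restrict (Ioo 0 r)).withDensity fun s => w s ^ (-p⁻¹ - 1) with hν
    have h1 : ∫⁻ s in Ioo 0 r, φ s / w s = ∫⁻ s, φ s * w s ^ p⁻¹ ∂ν := by
      rw [hν, lintegral_withDensity_eq_lintegral_mul _ (by fun_prop) (by fun_prop)]
      refine setLIntegral_congr_fun measurableSet_Ioo fun s hs => ?_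
      simp only [Pi.mul_apply]
      rw [mul_left_comm, ← ENNReal.rpow_add _ _ (hw0 s (hs.2.trans hr.2)) (hwt s),
        div_eq_mul_inv, ← ENNReal.rpow_neg_one]
      congr 2
      ring
    have h2 : ∫⁻ s, (φ s * w s ^ p⁻¹) ^ p ∂ν = ∫⁻ s in Ioo 0 r, G s := by
      rw [hν, lintegral_withDensity_eq_lintegral_mul _ (by fun_prop) (by fun_prop)]
      refine setLIntegral_congr_fun measurableSet_Ioo fun s hs => ?_
      simp only [Pi.mul_apply, hG]
      rw [ENNReal.mul_rpow_of_nonneg _ _ hp0.le, ← ENNReal.rpow_mul, mul_left_comm,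
        ← ENNReal.rpow_add _ _ (hw0 s (hs.2.trans hr.2)) (hwt s), inv_mul_cancel₀ hp0.ne']
      congr 2
      ring
    have h3 : ν univ ≤ ENNReal.ofReal p * w r ^ (-p⁻¹) := by
      rw [hν, withDensity_apply _ MeasurableSet.univ, Measure.restrict_univ]
      simpa using setLIntegral_one_sub_rpow_le (inv_pos.2 hp0) hr.1 hr.2
    rw [h1, ← h2, ← mul_assoc]
    refine (rpow_lintegral_le_mul_lintegral_rpow ν hp _).trans ?_
    gcongr
    calc ν univ ^ (p - 1) ≤ (ENNReal.ofReal p * w r ^ (-p⁻¹)) ^ (p - 1) :=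
          ENNReal.rpow_le_rpow h3 (by linarith)
      _ = _ := by
        rw [ENNReal.mul_rpow_of_nonneg _ _ (by linarith), ← ENNReal.rpow_mul]
        congr 2
        field_simp
        ring
  calc ∫⁻ r in Ioo (0 : ℝ) 1, (∫⁻ s in Ioo 0 r, φ s / w s) ^ p
      ≤ ∫⁻ r in Ioo (0 : ℝ) 1,
          ENNReal.ofReal p ^ (p - 1) * (w r ^ (p⁻¹ - 1) * ∫⁻ s in Ioo 0 r, G s) :=
        setLIntegral_mono' measurableSet_Ioo hpt
    _ = ENNReal.ofReal p ^ (p - 1) *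
          ∫⁻ r in Ioo (0 : ℝ) 1, w r ^ (p⁻¹ - 1) * ∫⁻ s in Ioo 0 r, G s :=
        lintegral_const_mul' _ _ (by finiteness)
    _ = ENNReal.ofReal p ^ (p - 1) * ∫⁻ r in Ioo (0 : ℝ) 1, ∫⁻ s in Ioo (0 : ℝ) 1,
          {x : ℝ × ℝ | x.2 < x.1}.indicator (fun x => w x.1 ^ (p⁻¹ - 1) * G x.2) (r, s) := by
        congr 1
        refine setLIntegral_congr_fun measurableSet_Ioo fun r hr => ?_
        rw [← lintegral_const_mul _ hGm,
          show Ioo (0 : ℝ) r = Iio r ∩ Ioo 0 1 by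
            ext x; simp only [mem_inter_iff, mem_Ioo, mem_Iio]; grind,
          ← setLIntegral_indicator measurableSet_Iio]
        rfl
    _ = ENNReal.ofReal p ^ (p - 1) * ∫⁻ s in Ioo (0 : ℝ) 1, ∫⁻ r in Ioo (0 : ℝ) 1,
          {x : ℝ × ℝ | x.2 < x.1}.indicator (fun x => w x.1 ^ (p⁻¹ - 1) * G x.2) (r, s) := by
        congr 1
        refine lintegral_lintegral_swap (Measurable.aemeasurable ?_)
        exact Measurable.indicator (by fun_prop) (measurableSet_lt measurable_snd measurable_fst)
    _ = ENNReal.ofReal p ^ (p - 1) * ∫⁻ s in Ioo (0 : ℝ) 1, ENNReal.ofReal p * φ s ^ p := by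
        congr 1
        refine setLIntegral_congr_fun measurableSet_Ioo fun s hs => ?_
        have h1 : ∀ r, {x : ℝ × ℝ | x.2 < x.1}.indicator
            (fun x => w x.1 ^ (p⁻¹ - 1) * G x.2) (r, s) =
            (Ioi s).indicator (fun r => w r ^ (p⁻¹ - 1) * G s) r := fun r => rfl
        simp only [h1]
        rw [setLIntegral_indicator measurableSet_Ioi,
          show Ioi s ∩ Ioo (0 : ℝ) 1 = Ioo s 1 by
            have := hs.1
            ext x; simp only [mem_inter_iff, mem_Ioo, mem_Ioi]; grind,
          lintegral_mul_const _ (by fun_prop), setLIntegral_one_sub_rpow (inv_pos.2 hp0) hs.2,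
          inv_inv, hG, mul_assoc]
        simp only
        rw [mul_left_comm (ENNReal.ofReal (1 - s) ^ p⁻¹),
          ← ENNReal.rpow_add _ _ (hw0 s hs.2) (hwt s)]
        simp
    _ = _ := by
        rw [lintegral_const_mul' _ _ (by finiteness), ← mul_assoc]
        congr 1
        nth_rw 2 [← ENNReal.rpow_one (ENNReal.ofReal p)]
        rw [← ENNReal.rpow_add _ _ (by simpa using hp0) (by finiteness), sub_add_cancel]

/-! ### Primitives along rays and the operator S_g. -/

theorem isOpen_unitDisc : IsOpen unitDisc := Metric.isOpen_ball

theorem mem_unitDisc {z : ℂ} : z ∈ unitDisc ↔ ‖z‖ < 1 := mem_ball_zero_iff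

theorem norm_ofReal_mul_exp {r : ℝ} (hr : 0 ≤ r) (θ : ℝ) :
    ‖(r : ℂ) * Complex.exp ((θ : ℂ) * Complex.I)‖ = r := by
  rw [norm_mul, Complex.norm_exp_ofReal_mul_I, mul_one, Complex.norm_real, Real.norm_of_nonneg hr]

theorem ofReal_mul_exp_mem_unitDisc {r : ℝ} (hr : r ∈ Ioo (0 : ℝ) 1) (θ : ℝ) :
    (r : ℂ) * Complex.exp ((θ : ℂ) * Complex.I) ∈ unitDisc := by
  rw [mem_unitDisc, norm_ofReal_mul_exp hr.1.le]
  exact hr.2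

/-- Values off the disc are arbitrary, so Tonelli and Hardy are applied to this truncation, which
agrees with `f` on the rays. -/
theorem IsAnalyticOnDisc.measurable_indicator {f : ℂ → ℂ} (hf : IsAnalyticOnDisc f) :
    Measurable (unitDisc.indicator f) := by
  classical
  rw [← piecewise_eq_indicator]
  exact ContinuousOn.measurable_piecewise hf.continuousOn continuousOn_const
    isOpen_unitDisc.measurableSet

theorem IsAnalyticOnDisc.deriv_mul {f g : ℂ → ℂ} (hf : IsAnalyticOnDisc f)
    (hg : IsAnalyticOnDisc g) : IsAnalyticOnDisc fun z => deriv f z * g z :=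
  (hf.deriv isOpen_unitDisc).mul hg

theorem IsAnalyticOnDisc.hasDerivAt {f : ℂ → ℂ} (hf : IsAnalyticOnDisc f) {z : ℂ}
    (hz : z ∈ unitDisc) : HasDerivAt f (deriv f z) z :=
  (hf.differentiableAt (isOpen_unitDisc.mem_nhds hz)).hasDerivAt

theorem ofReal_mul_mem_unitDisc {r t : ℝ} {u : ℂ} (hu : (r : ℂ) * u ∈ unitDisc)
    (ht : t ∈ uIcc 0 r) (hr : 0 ≤ r) : (t : ℂ) * u ∈ unitDisc := by
  rw [uIcc_of_le hr] at ht
  rw [mem_unitDisc, norm_mul, Complex.norm_real, Real.norm_of_nonneg (by linarith [ht.1])] at *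
  exact (mul_le_mul_of_nonneg_right ht.2 (norm_nonneg u)).trans_lt hu

theorem continuousOn_comp_ray {h : ℂ → ℂ} (hh : IsAnalyticOnDisc h) {r : ℝ} {u : ℂ}
    (hr : 0 ≤ r) (hu : (r : ℂ) * u ∈ unitDisc) :
    ContinuousOn (fun t : ℝ => h ((t : ℂ) * u) * u) (uIcc 0 r) :=
  (hh.continuousOn.comp (by fun_prop) fun _ ht => ofReal_mul_mem_unitDisc hu ht hr).mul
    continuousOn_const

theorem integral_ray_eq_sub {h H : ℂ → ℂ} (hh : IsAnalyticOnDisc h)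
    (hH : ∀ z ∈ unitDisc, HasDerivAt H (h z) z) {r : ℝ} {u : ℂ} (hr : 0 ≤ r)
    (hu : (r : ℂ) * u ∈ unitDisc) :
    ∫ t in (0 : ℝ)..r, h ((t : ℂ) * u) * u = H (r * u) - H 0 := by
  rw [intervalIntegral.integral_eq_sub_of_hasDerivAt (f := fun t : ℝ => H (t * u))]
  · simp
  · intro t ht
    have h1 : HasDerivAt (fun t : ℝ => (t : ℂ) * u) u t := by
      simpa using (HasDerivAt.ofReal_comp (hasDerivAt_id t)).mul_const u
    exact (hH _ (ofReal_mul_mem_unitDisc hu ht hr)).comp_of_eq t h1 rfl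
  · exact (continuousOn_comp_ray hh hr hu).intervalIntegrable

theorem exists_forall_hasDerivAt {h : ℂ → ℂ} (hh : IsAnalyticOnDisc h) :
    ∃ H : ℂ → ℂ, ∀ z ∈ unitDisc, HasDerivAt H (h z) z :=
  DifferentiableOn.isExactOn_ball hh

theorem opS_eq_sub {f g H : ℂ → ℂ} (hf : IsAnalyticOnDisc f) (hg : IsAnalyticOnDisc g)
    (hH : ∀ z ∈ unitDisc, HasDerivAt H (deriv f z * g z) z) {z : ℂ} (hz : z ∈ unitDisc) :
    opS g f z = H z - H 0 := by
  simpa [opS] using integral_ray_eq_sub (hf.deriv_mul hg) hH (r := 1) (u := z) zero_le_one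
    (by simpa using hz)

theorem hasDerivAt_opS {f g : ℂ → ℂ} (hf : IsAnalyticOnDisc f) (hg : IsAnalyticOnDisc g) {z : ℂ}
    (hz : z ∈ unitDisc) : HasDerivAt (opS g f) (deriv f z * g z) z := by
  obtain ⟨H, hH⟩ := exists_forall_hasDerivAt (hf.deriv_mul hg)
  refine ((hH z hz).sub_const (H 0)).congr_of_eventuallyEq ?_
  filter_upwards [isOpen_unitDisc.mem_nhds hz] with w hw
  exact opS_eq_sub hf hg hH hw

theorem isAnalyticOnDisc_opS {f g : ℂ → ℂ} (hf : IsAnalyticOnDisc f)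
    (hg : IsAnalyticOnDisc g) : IsAnalyticOnDisc (opS g f) :=
  fun _ hz => (hasDerivAt_opS hf hg hz).differentiableAt.differentiableWithinAt

/-- Integration by parts. -/
theorem opS_add_opS {f g : ℂ → ℂ} (hf : IsAnalyticOnDisc f) (hg : IsAnalyticOnDisc g) {z : ℂ}
    (hz : z ∈ unitDisc) : opS g f z + opS f g z = f z * g z - f 0 * g 0 := by
  obtain ⟨H, hH⟩ := exists_forall_hasDerivAt (hf.deriv_mul hg)
  have hK : ∀ w ∈ unitDisc, HasDerivAt (fun w => f w * g w - H w) (deriv g w * f w) w := by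
    intro w hw
    exact (((hf.hasDerivAt hw).fun_mul (hg.hasDerivAt hw)).fun_sub (hH w hw)).congr_deriv
      (by ring)
  rw [opS_eq_sub hf hg hH hz, opS_eq_sub hg hf hK hz]
  ring

theorem norm_deriv_le_of_norm_le {g : ℂ → ℂ} (hg : IsAnalyticOnDisc g) {M : ℝ}
    (hM : ∀ z ∈ unitDisc, ‖g z‖ ≤ M) {w : ℂ} (hw : w ∈ unitDisc) :
    ‖deriv g w‖ ≤ 2 * M / (1 - ‖w‖) := by
  rw [mem_unitDisc] at hw
  -- Half the distance to the unit circle; this is the source of the factor 2.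
  have hsub : Metric.closedBall w ((1 - ‖w‖) / 2) ⊆ unitDisc := by
    intro z hz
    rw [mem_closedBall_iff_norm] at hz
    rw [mem_unitDisc]
    linarith [norm_le_norm_add_norm_sub' z w]
  have := Complex.norm_deriv_le_of_forall_mem_sphere_norm_le (c := w) (R := (1 - ‖w‖) / 2)
    (by linarith) ((hg.mono hsub).diffContOnCl_ball subset_rfl)
    fun z hz => hM z (hsub (Metric.sphere_subset_closedBall hz))
  refine this.trans_eq ?_
  have : 1 - ‖w‖ ≠ 0 := by linarith
  field_simp

theorem enorm_opS_le_lintegral {f g : ℂ → ℂ} (hf : IsAnalyticOnDisc f) (hg : IsAnalyticOnDisc g)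
    {M : ℝ} (hM : ∀ z ∈ unitDisc, ‖g z‖ ≤ M) {r : ℝ} (hr : r ∈ Ioo (0 : ℝ) 1) (θ : ℝ) :
    ‖opS f g ((r : ℂ) * Complex.exp ((θ : ℂ) * Complex.I))‖ₑ ≤
      ENNReal.ofReal (2 * M) * ∫⁻ s in Ioo 0 r,
        ‖f ((s : ℂ) * Complex.exp ((θ : ℂ) * Complex.I))‖ₑ / ENNReal.ofReal (1 - s) := by
  obtain ⟨H, hH⟩ := exists_forall_hasDerivAt (hg.deriv_mul hf)
  have hz := ofReal_mul_exp_mem_unitDisc hr θ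
  rw [opS_eq_sub hg hf hH hz, ← integral_ray_eq_sub (hg.deriv_mul hf) hH hr.1.le hz,
    intervalIntegral.integral_of_le hr.1.le, integral_Ioc_eq_integral_Ioo,
    ← lintegral_const_mul' _ _ (by finiteness)]
  refine (enorm_integral_le_lintegral_enorm _).trans
    (setLIntegral_mono' measurableSet_Ioo fun s hs => ?_)
  have hs' : s ∈ Ioo (0 : ℝ) 1 := ⟨hs.1, hs.2.trans hr.2⟩
  have h1 : 0 < 1 - s := by linarith [hs'.2]
  have hd := norm_deriv_le_of_norm_le hg hM (ofReal_mul_exp_mem_unitDisc hs' θ)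
  rw [norm_ofReal_mul_exp hs.1.le] at hd
  have hd' := ENNReal.ofReal_le_ofReal hd
  rw [ofReal_norm, ENNReal.ofReal_div_of_pos h1] at hd'
  have he : ‖Complex.exp ((θ : ℂ) * Complex.I)‖ₑ = 1 := by
    rw [← ofReal_norm, Complex.norm_exp_ofReal_mul_I, ENNReal.ofReal_one]
  rw [enorm_mul, enorm_mul, he, mul_one, mul_div_assoc', mul_comm _ ‖f _‖ₑ, mul_comm _ ‖f _‖ₑ,
    mul_div_assoc]
  gcongr

/-! ### Bounded point evaluations on RM(p, q). -/

/-- Jensen twice, for the normalised measure in θ with exponent q and for dr on the unit interval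
with exponent p. -/
theorem mul_lintegral_lintegral_le_rhoRM {p q : ℝ} (hp : 1 ≤ p) (hq : 1 ≤ q) (F : ℂ → ℂ) :
    ENNReal.ofReal (1 / (2 * Real.pi)) * ∫⁻ θ in Ioo (0 : ℝ) (2 * Real.pi),
      ∫⁻ r in Ioo (0 : ℝ) 1, ‖F ((r : ℂ) * Complex.exp ((θ : ℂ) * Complex.I))‖ₑ ≤
        rhoRM p q F := by
  have hp0 : 0 < p := by linarith
  have hq0 : 0 < q := by linarith
  have hc : ENNReal.ofReal (1 / (2 * Real.pi)) * volume (Ioo (0 : ℝ) (2 * Real.pi)) = 1 := by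
    rw [Real.volume_Ioo, sub_zero, ← ENNReal.ofReal_mul (by positivity),
      one_div_mul_cancel (by positivity), ENNReal.ofReal_one]
  set c := ENNReal.ofReal (1 / (2 * Real.pi))
  rw [rhoRM, one_div q, ENNReal.le_rpow_inv_iff hq0, ← smul_eq_mul c, ← smul_eq_mul c,
    ← lintegral_smul_measure, ← lintegral_smul_measure]
  refine (rpow_lintegral_le_mul_lintegral_rpow _ hq _).trans ?_
  rw [Measure.smul_apply, Measure.restrict_apply_univ, smul_eq_mul, hc, ENNReal.one_rpow, one_mul]
  refine lintegral_mono fun θ => ?_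
  have h := rpow_lintegral_le_mul_lintegral_rpow (volume.restrict (Ioo (0 : ℝ) 1)) hp
    fun r : ℝ => ‖F ((r : ℂ) * Complex.exp ((θ : ℂ) * Complex.I))‖ₑ
  rw [Measure.restrict_apply_univ, Real.volume_Ioo, sub_zero, ENNReal.ofReal_one,
    ENNReal.one_rpow, one_mul] at h
  calc _ = ((∫⁻ r in Ioo (0 : ℝ) 1,
        ‖F ((r : ℂ) * Complex.exp ((θ : ℂ) * Complex.I))‖ₑ) ^ p) ^ (q / p) := by
        rw [← ENNReal.rpow_mul, mul_div_cancel₀ _ hp0.ne']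
    _ ≤ _ := by gcongr

theorem lintegral_lintegral_ray_swap {F : ℂ → ℂ} (hF : IsAnalyticOnDisc F) :
    ∫⁻ r in Ioo (0 : ℝ) 1, ∫⁻ θ in Ioo (0 : ℝ) (2 * Real.pi),
        ‖F ((r : ℂ) * Complex.exp ((θ : ℂ) * Complex.I))‖ₑ =
      ∫⁻ θ in Ioo (0 : ℝ) (2 * Real.pi), ∫⁻ r in Ioo (0 : ℝ) 1,
        ‖F ((r : ℂ) * Complex.exp ((θ : ℂ) * Complex.I))‖ₑ := by
  have hm := hF.measurable_indicator
  have h1 : ∀ r ∈ Ioo (0 : ℝ) 1, ∀ θ : ℝ, F ((r : ℂ) * Complex.exp ((θ : ℂ) * Complex.I)) =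
      unitDisc.indicator F ((r : ℂ) * Complex.exp ((θ : ℂ) * Complex.I)) := fun r hr θ =>
    (indicator_of_mem (ofReal_mul_exp_mem_unitDisc hr θ) F).symm
  calc _ = ∫⁻ r in Ioo (0 : ℝ) 1, ∫⁻ θ in Ioo (0 : ℝ) (2 * Real.pi),
        ‖unitDisc.indicator F ((r : ℂ) * Complex.exp ((θ : ℂ) * Complex.I))‖ₑ :=
        setLIntegral_congr_fun measurableSet_Ioo fun r hr => by simp only [h1 r hr]
    _ = ∫⁻ θ in Ioo (0 : ℝ) (2 * Real.pi), ∫⁻ r in Ioo (0 : ℝ) 1,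
        ‖unitDisc.indicator F ((r : ℂ) * Complex.exp ((θ : ℂ) * Complex.I))‖ₑ := by
        refine lintegral_lintegral_swap (Measurable.aemeasurable ?_)
        fun_prop
    _ = _ := lintegral_congr fun θ => setLIntegral_congr_fun measurableSet_Ioo
        fun r hr => by simp only [h1 r hr θ]

/-- Cauchy's formula gives a bound for values in a smaller disc by the integral over a circle. -/
theorem enorm_le_mul_lintegral_circle {F : ℂ → ℂ} (hF : IsAnalyticOnDisc F) {R r : ℝ}
    (hRr : R < r) (hr : r ∈ Ioo (0 : ℝ) 1) {w : ℂ} (hw : ‖w‖ ≤ R) :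
    ‖F w‖ₑ ≤ ENNReal.ofReal (r - R)⁻¹ * ∫⁻ θ in Ioo (0 : ℝ) (2 * Real.pi),
      ‖F ((r : ℂ) * Complex.exp ((θ : ℂ) * Complex.I))‖ₑ := by
  have hsub : Metric.closedBall (0 : ℂ) r ⊆ unitDisc := Metric.closedBall_subset_ball hr.2
  have hC := DifferentiableOn.circleIntegral_sub_inv_smul (c := 0) (w := w) (hF.mono hsub)
    (by rw [mem_ball_zero_iff]; linarith)
  -- The factor 2πi has modulus at least 1 and can be dropped.
  have h1 : ‖F w‖ₑ ≤ ‖(2 * Real.pi * Complex.I : ℂ) • F w‖ₑ := by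
    rw [enorm_smul]
    refine le_mul_of_one_le_left' ?_
    rw [← ofReal_norm, ENNReal.one_le_ofReal]
    simp only [norm_mul, Complex.norm_I, Complex.norm_real, Complex.norm_ofNat, mul_one,
      Real.norm_of_nonneg Real.pi_nonneg]
    linarith [Real.pi_gt_three]
  rw [← hC, circleIntegral, intervalIntegral.integral_of_le (by positivity),
    integral_Ioc_eq_integral_Ioo] at h1
  refine h1.trans ((enorm_integral_le_lintegral_enorm _).trans ?_)
  rw [← lintegral_const_mul' _ _ (by finiteness)]
  refine lintegral_mono fun θ => ?_
  have hz : circleMap 0 r θ = (r : ℂ) * Complex.exp ((θ : ℂ) * Complex.I) := circleMap_zero r θ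
  rw [hz, ← smul_assoc, enorm_smul]
  gcongr
  rw [← ofReal_norm]
  apply ENNReal.ofReal_le_ofReal
  rw [smul_eq_mul, norm_mul, deriv_circleMap, norm_mul, Complex.norm_I, mul_one, hz, norm_inv,
    norm_ofReal_mul_exp hr.1.le]
  have h2 : r - R ≤ ‖(r : ℂ) * Complex.exp ((θ : ℂ) * Complex.I) - w‖ := by
    have := norm_sub_norm_le ((r : ℂ) * Complex.exp ((θ : ℂ) * Complex.I)) w
    rw [norm_ofReal_mul_exp hr.1.le] at this
    linarith
  have h3 : 0 < r - R := by linarith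
  calc _ ≤ 1 * (r - R)⁻¹ := by
        gcongr
        exact hr.2.le
    _ = _ := one_mul _

/-- Point evaluations are bounded on `RM(p, q)`, uniformly on smaller discs. -/
theorem exists_enorm_le_mul_rhoRM {p q : ℝ} (hp : 1 ≤ p) (hq : 1 ≤ q) {R : ℝ} (hR0 : 0 ≤ R)
    (hR : R < 1) : ∃ K : ℝ≥0, ∀ F : ℂ → ℂ, IsAnalyticOnDisc F → ∀ w : ℂ, ‖w‖ ≤ R →
      ‖F w‖ₑ ≤ K * rhoRM p q F := by
  set c : ℝ≥0∞ := ENNReal.ofReal (1 / (2 * Real.pi))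
  set d : ℝ≥0∞ := ENNReal.ofReal ((1 - R) / 2)
  set e : ℝ≥0∞ := ENNReal.ofReal ((1 - R) / 2)⁻¹
  have hc : c ≠ 0 := by simp [c, Real.pi_pos]
  have hd : d ≠ 0 := by simpa [d] using hR
  refine ⟨(d⁻¹ * e * c⁻¹).toNNReal, fun F hF w hw => ?_⟩
  rw [ENNReal.coe_toNNReal (by finiteness)]
  set T := ∫⁻ θ in Ioo (0 : ℝ) (2 * Real.pi), ∫⁻ r in Ioo (0 : ℝ) 1,
    ‖F ((r : ℂ) * Complex.exp ((θ : ℂ) * Complex.I))‖ₑ with hT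
  -- Averaging over circles of radius r > (1+R)/2, which stay at distance at least (1-R)/2 from the
  -- disc of radius R.
  have h1 : d * ‖F w‖ₑ ≤ e * T := by
    calc d * ‖F w‖ₑ = ∫⁻ _ in Ioo ((1 + R) / 2) 1, ‖F w‖ₑ := by
          rw [setLIntegral_const, Real.volume_Ioo, mul_comm,
            show 1 - (1 + R) / 2 = (1 - R) / 2 by ring]
      _ ≤ ∫⁻ r in Ioo ((1 + R) / 2) 1, e * ∫⁻ θ in Ioo (0 : ℝ) (2 * Real.pi),
            ‖F ((r : ℂ) * Complex.exp ((θ : ℂ) * Complex.I))‖ₑ := by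
          refine setLIntegral_mono' measurableSet_Ioo fun r hr => ?_
          refine (enorm_le_mul_lintegral_circle hF (R := R) (by linarith [hr.1])
            ⟨by linarith [hr.1], hr.2⟩ hw).trans ?_
          gcongr
          exact ENNReal.ofReal_le_ofReal (inv_anti₀ (by linarith) (by linarith [hr.1]))
      _ ≤ ∫⁻ r in Ioo (0 : ℝ) 1, e * ∫⁻ θ in Ioo (0 : ℝ) (2 * Real.pi),
            ‖F ((r : ℂ) * Complex.exp ((θ : ℂ) * Complex.I))‖ₑ :=
          lintegral_mono_set (Ioo_subset_Ioo_left (by linarith))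
      _ = e * T := by
          rw [lintegral_const_mul' _ _ (by finiteness), lintegral_lintegral_ray_swap hF]
  have h2 : c * T ≤ rhoRM p q F := mul_lintegral_lintegral_le_rhoRM hp hq F
  calc ‖F w‖ₑ = d⁻¹ * (d * ‖F w‖ₑ) := by
        rw [← mul_assoc, ENNReal.inv_mul_cancel hd (by finiteness), one_mul]
    _ ≤ d⁻¹ * (e * (c⁻¹ * (c * T))) := by
        rw [← mul_assoc c⁻¹, ENNReal.inv_mul_cancel hc (by finiteness), one_mul]
        gcongr
    _ ≤ d⁻¹ * (e * (c⁻¹ * rhoRM p q F)) := by gcongr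
    _ = _ := by ring

/-! ### Sufficiency: bounded symbols. -/

/-- The larger summand dominates. The crude constant covers exponents below 1, needed because q/p
may be less than 1. -/
theorem ENNReal.add_rpow_le_two_rpow_mul {s : ℝ} (hs : 0 ≤ s) (x y : ℝ≥0∞) :
    (x + y) ^ s ≤ 2 ^ s * (x ^ s + y ^ s) := by
  rcases le_total x y with h | h
  · calc (x + y) ^ s ≤ (2 * y) ^ s := by rw [two_mul]; gcongr
      _ = 2 ^ s * y ^ s := ENNReal.mul_rpow_of_nonneg _ _ hs
      _ ≤ _ := by gcongr; exact le_add_self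
  · calc (x + y) ^ s ≤ (2 * x) ^ s := by rw [two_mul]; gcongr
      _ = 2 ^ s * x ^ s := ENNReal.mul_rpow_of_nonneg _ _ hs
      _ ≤ _ := by gcongr; exact le_self_add

theorem enorm_opS_ray_le {f g : ℂ → ℂ} (hf : IsAnalyticOnDisc f) (hg : IsAnalyticOnDisc g)
    {M : ℝ} (hM : ∀ z ∈ unitDisc, ‖g z‖ ≤ M) {r : ℝ} (hr : r ∈ Ioo (0 : ℝ) 1) (θ : ℝ) :
    ‖opS g f ((r : ℂ) * Complex.exp ((θ : ℂ) * Complex.I))‖ₑ ≤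
      ENNReal.ofReal (2 * M) * (‖f ((r : ℂ) * Complex.exp ((θ : ℂ) * Complex.I))‖ₑ + ‖f 0‖ₑ +
        ∫⁻ s in Ioo 0 r,
          ‖f ((s : ℂ) * Complex.exp ((θ : ℂ) * Complex.I))‖ₑ / ENNReal.ofReal (1 - s)) := by
  have hz := ofReal_mul_exp_mem_unitDisc hr θ
  have hT := enorm_opS_le_lintegral hf hg hM hr θ
  set z := (r : ℂ) * Complex.exp ((θ : ℂ) * Complex.I)
  have h0 : (0 : ℂ) ∈ unitDisc := by simp [unitDisc]
  have hM0 : 0 ≤ M := (norm_nonneg _).trans (hM 0 h0)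
  have hgM : ∀ w ∈ unitDisc, ‖g w‖ₑ ≤ ENNReal.ofReal (2 * M) := fun w hw => by
    rw [← ofReal_norm]
    exact ENNReal.ofReal_le_ofReal ((hM w hw).trans (by linarith))
  have heq : opS g f z = f z * g z - f 0 * g 0 - opS f g z := by
    rw [← opS_add_opS hf hg hz]
    ring
  rw [heq, mul_add, mul_add]
  refine enorm_sub_le.trans (add_le_add (enorm_sub_le.trans (add_le_add ?_ ?_)) hT)
  · rw [enorm_mul, mul_comm]
    gcongr
    exact hgM z hz
  · rw [enorm_mul, mul_comm]
    gcongr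
    exact hgM 0 h0

theorem lintegral_opS_ray_rpow_le {p : ℝ} (hp : 1 ≤ p) {g : ℂ → ℂ} (hg : IsAnalyticOnDisc g)
    {M : ℝ} (hM : ∀ z ∈ unitDisc, ‖g z‖ ≤ M) :
    ∃ A : ℝ≥0, ∀ f : ℂ → ℂ, IsAnalyticOnDisc f → ∀ θ : ℝ,
      ∫⁻ r in Ioo (0 : ℝ) 1, ‖opS g f ((r : ℂ) * Complex.exp ((θ : ℂ) * Complex.I))‖ₑ ^ p ≤
        A * ((∫⁻ r in Ioo (0 : ℝ) 1, ‖f ((r : ℂ) * Complex.exp ((θ : ℂ) * Complex.I))‖ₑ ^ p) +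
          ‖f 0‖ₑ ^ p) := by
  have hp0 : 0 < p := by linarith
  set m := ENNReal.ofReal (2 * M)
  set B : ℝ≥0∞ := m ^ p * (2 ^ p * 2 ^ p)
  have hB : B ≠ ∞ := by finiteness
  set H : ℝ≥0∞ := ENNReal.ofReal p ^ p
  have hH : H ≠ ∞ := by finiteness
  refine ⟨(B * (1 + H)).toNNReal, fun f hf θ => ?_⟩
  rw [ENNReal.coe_toNNReal (by finiteness)]
  set φ : ℝ → ℝ≥0∞ := fun r =>
    ‖unitDisc.indicator f ((r : ℂ) * Complex.exp ((θ : ℂ) * Complex.I))‖ₑ with hφ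
  have hφm : Measurable φ := by
    have := hf.measurable_indicator
    fun_prop
  have hφe : ∀ r ∈ Ioo (0 : ℝ) 1, ‖f ((r : ℂ) * Complex.exp ((θ : ℂ) * Complex.I))‖ₑ = φ r :=
    fun r hr => by rw [hφ]; simp only [indicator_of_mem (ofReal_mul_exp_mem_unitDisc hr θ) f]
  have hI : ∫⁻ r in Ioo (0 : ℝ) 1, ‖f ((r : ℂ) * Complex.exp ((θ : ℂ) * Complex.I))‖ₑ ^ p =
      ∫⁻ r in Ioo (0 : ℝ) 1, φ r ^ p :=
    setLIntegral_congr_fun measurableSet_Ioo fun r hr => by simp only [hφe r hr]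
  rw [hI]
  set h : ℝ → ℝ≥0∞ := fun r => ∫⁻ s in Ioo 0 r, φ s / ENNReal.ofReal (1 - s)
  calc _ ≤ ∫⁻ r in Ioo (0 : ℝ) 1, B * (φ r ^ p + ‖f 0‖ₑ ^ p + h r ^ p) := by
        refine setLIntegral_mono' measurableSet_Ioo fun r hr => ?_
        have h1 := enorm_opS_ray_le hf hg hM hr θ
        have h2 : ∫⁻ s in Ioo 0 r,
            ‖f ((s : ℂ) * Complex.exp ((θ : ℂ) * Complex.I))‖ₑ / ENNReal.ofReal (1 - s) = h r :=
          setLIntegral_congr_fun measurableSet_Ioo fun s hs => by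
            simp only [hφe s ⟨hs.1, hs.2.trans hr.2⟩]
        rw [h2, hφe r hr] at h1
        have h3 : (1 : ℝ≥0∞) ≤ 2 ^ p := ENNReal.one_le_rpow one_le_two hp0
        calc _ ≤ (m * (φ r + ‖f 0‖ₑ + h r)) ^ p := by gcongr
          _ = m ^ p * (φ r + ‖f 0‖ₑ + h r) ^ p := ENNReal.mul_rpow_of_nonneg _ _ hp0.le
          _ ≤ m ^ p * (2 ^ p * ((φ r + ‖f 0‖ₑ) ^ p + h r ^ p)) := by
              gcongr
              exact ENNReal.add_rpow_le_two_rpow_mul hp0.le _ _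
          _ ≤ m ^ p * (2 ^ p * (2 ^ p * (φ r ^ p + ‖f 0‖ₑ ^ p) +
                2 ^ p * h r ^ p)) := by
              gcongr
              · exact ENNReal.add_rpow_le_two_rpow_mul hp0.le _ _
              · exact le_mul_of_one_le_left' h3
          _ = B * (φ r ^ p + ‖f 0‖ₑ ^ p + h r ^ p) := by ring
    _ = B * ((∫⁻ r in Ioo (0 : ℝ) 1, φ r ^ p) + ‖f 0‖ₑ ^ p +
          ∫⁻ r in Ioo (0 : ℝ) 1, h r ^ p) := by
        rw [lintegral_const_mul' _ _ hB, lintegral_add_left (by fun_prop),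
          lintegral_add_left (by fun_prop), setLIntegral_const]
        simp
    _ ≤ B * ((∫⁻ r in Ioo (0 : ℝ) 1, φ r ^ p) + ‖f 0‖ₑ ^ p +
          H * ∫⁻ r in Ioo (0 : ℝ) 1, φ r ^ p) := by
        gcongr
        exact lintegral_rpow_hardy_le hp hφm
    -- The superfluous term lets the factor 1 + H come out.
    _ ≤ B * ((∫⁻ r in Ioo (0 : ℝ) 1, φ r ^ p) + ‖f 0‖ₑ ^ p +
          (H * (∫⁻ r in Ioo (0 : ℝ) 1, φ r ^ p) + H * ‖f 0‖ₑ ^ p)) := by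
        gcongr
        exact le_self_add
    _ = _ := by ring

theorem exists_rhoRM_opS_le {p q : ℝ} (hp : 1 ≤ p) (hq : 1 ≤ q) {g : ℂ → ℂ}
    (hg : MemHInfty g) : ∃ C : ℝ≥0, ∀ f : ℂ → ℂ, IsAnalyticOnDisc f →
      rhoRM p q (opS g f) ≤ C * rhoRM p q f := by
  have hp0 : 0 < p := by linarith
  have hq0 : 0 < q := by linarith
  obtain ⟨hga, M, hM⟩ := hg
  obtain ⟨A, hA⟩ := lintegral_opS_ray_rpow_le hp hga hM
  obtain ⟨K, hK⟩ := exists_enorm_le_mul_rhoRM hp hq le_rfl one_pos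
  set D : ℝ≥0∞ := (A : ℝ≥0∞) ^ (q / p) * 2 ^ (q / p)
  have hD : D ≠ ∞ := by finiteness
  refine ⟨((D * (1 + (K : ℝ≥0∞) ^ q)) ^ (1 / q)).toNNReal, fun f hf => ?_⟩
  rw [ENNReal.coe_toNNReal (by finiteness)]
  have hf0 := hK f hf 0 (by simp)
  have hc : ENNReal.ofReal (1 / (2 * Real.pi)) * volume (Ioo (0 : ℝ) (2 * Real.pi)) = 1 := by
    rw [Real.volume_Ioo, sub_zero, ← ENNReal.ofReal_mul (by positivity),
      one_div_mul_cancel (by positivity), ENNReal.ofReal_one]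
  set J : ℝ → ℝ≥0∞ := fun θ => (∫⁻ r in Ioo (0 : ℝ) 1,
    ‖f ((r : ℂ) * Complex.exp ((θ : ℂ) * Complex.I))‖ₑ ^ p) ^ (q / p)
  have hrho : rhoRM p q f ^ q = ENNReal.ofReal (1 / (2 * Real.pi)) *
      ∫⁻ θ in Ioo (0 : ℝ) (2 * Real.pi), J θ := by
    rw [rhoRM, ← ENNReal.rpow_mul, one_div_mul_cancel hq0.ne', ENNReal.rpow_one]
  conv_lhs => rw [rhoRM]
  rw [one_div q, ENNReal.rpow_inv_le_iff hq0, ENNReal.mul_rpow_of_nonneg _ _ hq0.le,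
    ← ENNReal.rpow_mul, inv_mul_cancel₀ hq0.ne', ENNReal.rpow_one]
  set c := ENNReal.ofReal (1 / (2 * Real.pi))
  calc _ ≤ c * ∫⁻ θ in Ioo (0 : ℝ) (2 * Real.pi), D * (J θ + ‖f 0‖ₑ ^ q) := by
        gcongr with θ
        refine (ENNReal.rpow_le_rpow (hA f hf θ) (by positivity)).trans ?_
        rw [ENNReal.mul_rpow_of_nonneg _ _ (by positivity), mul_assoc]
        gcongr
        refine (ENNReal.add_rpow_le_two_rpow_mul (by positivity) _ _).trans_eq ?_
        rw [← ENNReal.rpow_mul ‖f 0‖ₑ, mul_div_cancel₀ _ hp0.ne']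
    _ = D * (rhoRM p q f ^ q + (c * volume (Ioo (0 : ℝ) (2 * Real.pi))) * ‖f 0‖ₑ ^ q) := by
        rw [lintegral_const_mul' _ _ hD, lintegral_add_right _ measurable_const,
          setLIntegral_const, hrho]
        ring
    _ ≤ D * (rhoRM p q f ^ q + ((K : ℝ≥0∞) * rhoRM p q f) ^ q) := by
        rw [hc, one_mul]
        gcongr
    _ = _ := by
        rw [ENNReal.mul_rpow_of_nonneg _ _ hq0.le]
        ring

/-! ### Necessity: iterating S_g on the identity. -/

theorem memRM_id {p q : ℝ} (hp : 1 ≤ p) (hq : 1 ≤ q) : MemRM p q id := by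
  have hp0 : 0 < p := by linarith
  have hq0 : 0 < q := by linarith
  refine ⟨differentiableOn_id, ?_⟩
  rw [rhoRM]
  refine ENNReal.rpow_lt_top_of_nonneg (by positivity) (ENNReal.mul_ne_top (by finiteness) ?_)
  have hin : ∀ θ : ℝ, ∫⁻ r in Ioo (0 : ℝ) 1,
      ‖id ((r : ℂ) * Complex.exp ((θ : ℂ) * Complex.I))‖ₑ ^ p ≤ 1 := fun θ => by
    calc _ ≤ ∫⁻ _ in Ioo (0 : ℝ) 1, 1 := by
          refine setLIntegral_mono' measurableSet_Ioo fun r hr => ?_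
          refine ENNReal.rpow_le_one ?_ hp0.le
          rw [id, ← ofReal_norm, norm_ofReal_mul_exp hr.1.le, ENNReal.ofReal_le_one]
          exact hr.2.le
      _ = 1 := by simp
  refine ne_top_of_le_ne_top (b := ∫⁻ _ in Ioo (0 : ℝ) (2 * Real.pi), 1) ?_
    (lintegral_mono fun θ => ENNReal.rpow_le_one (hin θ) (by positivity))
  rw [setLIntegral_const, Real.volume_Ioo]
  finiteness

/-- Cauchy's estimate on the circle about `a` of radius (1-|a|)/2, where point evaluations are
uniformly bounded. -/
theorem exists_enorm_deriv_le_mul_rhoRM {p q : ℝ} (hp : 1 ≤ p) (hq : 1 ≤ q) {a : ℂ}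
    (ha : a ∈ unitDisc) : ∃ K : ℝ≥0, ∀ F : ℂ → ℂ, MemRM p q F →
      ‖deriv F a‖ₑ ≤ K * rhoRM p q F := by
  rw [mem_unitDisc] at ha
  obtain ⟨K, hK⟩ := exists_enorm_le_mul_rhoRM hp hq (R := (1 + ‖a‖) / 2) (by positivity)
    (by linarith)
  set δ := (1 - ‖a‖) / 2 with hδ
  have hδ0 : 0 < δ := by linarith
  refine ⟨K / δ.toNNReal, fun F hF => ?_⟩
  have hball : ∀ z ∈ Metric.closedBall a δ, ‖z‖ ≤ (1 + ‖a‖) / 2 := fun z hz => by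
    rw [mem_closedBall_iff_norm] at hz
    linarith [norm_le_norm_add_norm_sub' z a]
  have hsub : Metric.closedBall a δ ⊆ unitDisc := fun z hz => by
    rw [mem_unitDisc]
    linarith [hball z hz]
  lift rhoRM p q F to ℝ≥0 using hF.2.ne with ρ hρ
  have hd := Complex.norm_deriv_le_of_forall_mem_sphere_norm_le (C := K * ρ) hδ0
    ((hF.1.mono hsub).diffContOnCl_ball subset_rfl) fun z hz => by
      have := hK F hF.1 z (hball z (Metric.sphere_subset_closedBall hz))
      rw [← hρ] at this
      exact_mod_cast this
  rw [← ENNReal.coe_mul, enorm_le_coe, ← NNReal.coe_le_coe]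
  push_cast
  rw [Real.coe_toNNReal _ hδ0.le, div_mul_eq_mul_div]
  exact hd

theorem deriv_iterate_opS {g : ℂ → ℂ} (hg : IsAnalyticOnDisc g) (n : ℕ) :
    IsAnalyticOnDisc ((opS g)^[n] id) ∧
      ∀ z ∈ unitDisc, deriv ((opS g)^[n] id) z = g z ^ n := by
  induction n with
  | zero => exact ⟨differentiableOn_id, fun z _ => by simp⟩
  | succ n ih =>
    rw [Function.iterate_succ_apply']
    refine ⟨isAnalyticOnDisc_opS ih.1 hg, fun z hz => ?_⟩
    rw [(hasDerivAt_opS ih.1 hg hz).deriv, ih.2 z hz, pow_succ]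

theorem iterate_opS_le {p q : ℝ} {g f : ℂ → ℂ} {C : ℝ≥0} (hf : MemRM p q f)
    (hC : ∀ f : ℂ → ℂ, MemRM p q f →
      MemRM p q (opS g f) ∧ rhoRM p q (opS g f) ≤ C * rhoRM p q f) (n : ℕ) :
    MemRM p q ((opS g)^[n] f) ∧ rhoRM p q ((opS g)^[n] f) ≤ (C : ℝ≥0∞) ^ n * rhoRM p q f := by
  induction n with
  | zero => simpa using hf
  | succ n ih =>
    rw [Function.iterate_succ_apply']
    refine ⟨(hC _ ih.1).1, (hC _ ih.1).2.trans ?_⟩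
    rw [pow_succ', mul_assoc]
    gcongr
    exact ih.2

/-- If x > C > 0, the powers of x/C would exceed the fixed `L`; for C = 0 the case n = 1 suffices.
-/
theorem le_of_forall_pow_le_mul_pow {x C L : ℝ} (hC : 0 ≤ C)
    (h : ∀ n : ℕ, x ^ n ≤ L * C ^ n) : x ≤ C := by
  by_contra! hx
  rcases hC.eq_or_lt with rfl | hC
  · have := h 1
    simp only [pow_one, mul_zero] at this
    linarith
  · obtain ⟨n, hn⟩ := pow_unbounded_of_one_lt L ((one_lt_div hC).2 hx)
    rw [div_pow, lt_div_iff₀ (by positivity)] at hn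
    exact (h n).not_gt hn

theorem norm_le_of_isBoundedOpS {p q : ℝ} (hp : 1 ≤ p) (hq : 1 ≤ q) {g : ℂ → ℂ}
    (hg : IsAnalyticOnDisc g) {C : ℝ≥0} (hC : ∀ f : ℂ → ℂ, MemRM p q f →
      MemRM p q (opS g f) ∧ rhoRM p q (opS g f) ≤ C * rhoRM p q f) {a : ℂ}
    (ha : a ∈ unitDisc) : ‖g a‖ ≤ C := by
  obtain ⟨K, hK⟩ := exists_enorm_deriv_le_mul_rhoRM hp hq ha
  have hid := memRM_id hp hq
  obtain ⟨ρ, hρ⟩ : ∃ ρ : ℝ≥0, (ρ : ℝ≥0∞) = rhoRM p q id := ⟨_, ENNReal.coe_toNNReal hid.2.ne⟩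
  refine le_of_forall_pow_le_mul_pow (L := K * ρ) C.2 fun n => ?_
  obtain ⟨hmem, hle⟩ := iterate_opS_le hid hC n
  have h := (hK _ hmem).trans (mul_le_mul_right hle _)
  rw [(deriv_iterate_opS hg n).2 a ha, ← hρ, ← ENNReal.coe_pow, ← ENNReal.coe_mul,
    ← ENNReal.coe_mul, enorm_le_coe, ← NNReal.coe_le_coe, coe_nnnorm, norm_pow] at h
  push_cast at h
  refine h.trans_eq ?_
  ring

theorem mainTheorem5 (p q : ℝ) (hp : 1 ≤ p) (hq : 1 ≤ q) (g : ℂ → ℂ)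
    (hg : IsAnalyticOnDisc g) :
    IsBoundedOpS p q g ↔ MemHInfty g := by
  constructor
  · rintro ⟨C, hC⟩
    exact ⟨hg, C, fun z hz => norm_le_of_isBoundedOpS hp hq hg hC hz⟩
  · intro h
    obtain ⟨C, hC⟩ := exists_rhoRM_opS_le hp hq h
    refine ⟨C, fun f hf => ⟨⟨isAnalyticOnDisc_opS hf.1 hg, ?_⟩, hC f hf.1⟩⟩
    exact (hC f hf.1).trans_lt (ENNReal.mul_lt_top ENNReal.coe_lt_top hf.2)
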